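/- Let $n\in\mathbb{N}$ and equip $\mathbb{R}^{2n}$ with the measure $\mathrm{d}\mu(\xi)=\frac{\mathrm{d}^{2n}\xi}{(2\pi)^n}$. Let $M$ be a quantum system with complex Hilbert space $\mathcal H$, and let $R$ be a classical system with values in $\mathbb{R}^{2n}$. A state $\rho_{RM}$ is a (Bochner) measurable family $\{\rho_{RM}(\xi)\}_{\xi\in\mathbb{R}^{2n}}$ of positive trace class operators on $\mathcal H$ with $\int \mathrm{tr}[\rho_{RM}(\xi)]\,\mathrm{d}\mu(\xi)=1$; put $\rho_R(\xi)=\mathrm{tr}\,\rho_{RM}(\xi)$, $\rho_M=\int\rho_{RM}(\xi)\,\mathrm{d}\mu(\xi)$ and $\rho_{M|R=\xi}=\rho_{RM}(\xi)/\rho_R(\xi)$, and use the same notions for any other classical system with a reference measure. Let $S(\rho)=-\mathrm{tr}[\rho\log\rho]$ be the von Neumann entropy, $S(R)=-\int\rho_R\log\rho_R\,\mathrm{d}\mu$, $S(M)=S(\rho_M)$, $S(M|R)=\int S(\rho_{M|R=\xi})\,\rho_R(\xi)\,\mathrm{d}\mu(\xi)$, and, whenever these three quantities are finite, $$S(R|M)=S(M|R)+S(R)-S(M).$$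 For classical systems $R,Z$ let $I(R:Z|M)=S(R|M)+S(Z|M)-S(RZ|M)$. For $t>0$ let $f_{Z,t}(z)=t^{-n}e^{-|z|^2/(2t)}$ (a probability density with respect to $\mu$), let $\sigma_{RZM}(t)$ be the state $\sigma_{RZM}(t)(\xi,z)=f_{Z,t}(z)\,\rho_{RM}(\xi-z)$ (its marginal on $Z$ is $f_{Z,t}$, and given $Z=z$ the system $R$ is displaced by $z$), and set $$\Delta_{R|M}(\rho_{RM})(t):=I(R:Z|M)_{\sigma_{RZM}(t)},\qquad \big((\mathcal N_{\mathrm{cl}}(t)\otimes\mathbb 1_M)(\rho_{RM})\big)(\eta):=\int f_{Z,t}(\xi)\,\rho_{RM}(\eta-\xi)\,\mathrm{d}\mu(\xi).$$ For $t=0$ let $\Delta_{R|M}(\rho_{RM})(0):=0$ and $\mathcal N_{\mathrm{cl}}(0):=\mathbb 1$. Theorem (integral conditional de Bruijn identity). Let $t\ge 0$ and let $\rho_{RM}$ be a state such that $S(R|M)$ is defined (that is, $S(M|R)$, $S(R)$ and $S(M)$ are finite) both for $\rho_{RM}$ and for $(\mathcal N_{\mathrm{cl}}(t)\otimes\mathbb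 1_M)(\rho_{RM})$. Then, if $t>0$, the conditional entropies $S(R|M)$, $S(Z|M)$ and $S(RZ|M)$ of $\sigma_{RZM}(t)$ are all defined, and for every such $t\ge 0$ $$\Delta_{R|M}(\rho_{RM})(t)=S(R|M)_{(\mathcal N_{\mathrm{cl}}(t)\otimes\mathbb 1_M)(\rho_{RM})}-S(R|M)_{\rho_{RM}}.$$ -/

import Mathlib

open MeasureTheory
open scoped ENNReal

noncomputable section

/-! ### Operators on the Hilbert space `H` of the quantum system `M` -/

/-- The trace `∑ᵢ ⟨bᵢ, A bᵢ⟩ ∈ [0, ∞]` of a positive operator `A`, computed in some Hilbert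
basis `b` of `H`. It is only used for positive operators, for which it does not depend on `b`
and is finite exactly when `A` is trace class. -/
def opTrace {H : Type*} [NormedAddCommGroup H] [InnerProductSpace ℂ H] [CompleteSpace H]
    (A : H →L[ℂ] H) : ℝ≥0∞ :=
  ∑' i, ENNReal.ofReal
    (inner ℂ ((exists_hilbertBasis ℂ H).choose_spec.choose i)
      (A ((exists_hilbertBasis ℂ H).choose_spec.choose i))).re

/-- The von Neumann entropy `S(ρ) = - tr (ρ log ρ) ∈ [0, ∞]` of a state `ρ`; the operator
`- ρ log ρ` (with `0 log 0 = 0`) is given by the continuous functional calculus, and it is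
positive because a state has its spectrum in `[0, 1]`. -/
def vonNeumannEntropy {H : Type*} [NormedAddCommGroup H] [InnerProductSpace ℂ H]
    [CompleteSpace H] (ρ : H →L[ℂ] H) : ℝ≥0∞ :=
  opTrace (cfc Real.negMulLog ρ)

/-! ### Classical-quantum states

The classical system takes values in a measure space `(X, μ)`, and densities are taken with
respect to `μ`. -/

/-- `ρ : X → B(H)` is a state of the classical-quantum system: a measurable collection of
positive trace class operators with total trace one. -/
structure IsCQState {X : Type*} [MeasurableSpace X] (μ : Measure X)
    {H : Type*} [NormedAddCommGroup H] [InnerProductSpace ℂ H] [CompleteSpace H]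
    (ρ : X → (H →L[ℂ] H)) : Prop where
  stronglyMeasurable : StronglyMeasurable ρ
  isPositive : ∀ ξ, (ρ ξ).IsPositive
  trace_ne_top : ∀ ξ, opTrace (ρ ξ) ≠ ∞
  lintegral_trace : ∫⁻ ξ, opTrace (ρ ξ) ∂μ = 1

/-- The marginal probability density `ρ_R(ξ) = tr_M ρ_RM(ξ)` of the classical system. -/
def classicalMarginal {X : Type*}
    {H : Type*} [NormedAddCommGroup H] [InnerProductSpace ℂ H] [CompleteSpace H]
    (ρ : X → (H →L[ℂ] H)) (ξ : X) : ℝ :=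
  (opTrace (ρ ξ)).toReal

/-- The marginal `ρ_M = ∫ ρ_RM(ξ) dμ(ξ)` on the quantum system. -/
def quantumMarginal {X : Type*} [MeasurableSpace X] (μ : Measure X)
    {H : Type*} [NormedAddCommGroup H] [InnerProductSpace ℂ H] [CompleteSpace H]
    (ρ : X → (H →L[ℂ] H)) : H →L[ℂ] H :=
  ∫ ξ, ρ ξ ∂μ

/-- The conditional state `ρ_{M|R=ξ} = ρ_RM(ξ) / ρ_R(ξ)` (zero where `ρ_R(ξ) = 0`). -/
def conditionalState {X : Type*}
    {H : Type*} [NormedAddCommGroup H] [InnerProductSpace ℂ H] [CompleteSpace H]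
    (ρ : X → (H →L[ℂ] H)) (ξ : X) : H →L[ℂ] H :=
  (classicalMarginal ρ ξ)⁻¹ • ρ ξ

/-- The Shannon differential entropy `S(f) = - ∫ f log f dμ`. -/
def shannonEntropy {X : Type*} [MeasurableSpace X] (μ : Measure X) (f : X → ℝ) : ℝ :=
  ∫ ξ, Real.negMulLog (f ξ) ∂μ

/-- The entropy `S(M|R) = ∫ S(ρ_{M|R=ξ}) ρ_R(ξ) dμ(ξ)` of the quantum system conditioned on
the classical system. -/
def entropyQGivenC {X : Type*} [MeasurableSpace X] (μ : Measure X)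
    {H : Type*} [NormedAddCommGroup H] [InnerProductSpace ℂ H] [CompleteSpace H]
    (ρ : X → (H →L[ℂ] H)) : ℝ≥0∞ :=
  ∫⁻ ξ, vonNeumannEntropy (conditionalState ρ ξ) *
    ENNReal.ofReal (classicalMarginal ρ ξ) ∂μ

/-- The three entropies `S(M|R)`, `S(R)`, `S(M)` are finite, i.e. `S(R|M)` is defined. -/
structure HasFiniteEntropies {X : Type*} [MeasurableSpace X] (μ : Measure X)
    {H : Type*} [NormedAddCommGroup H] [InnerProductSpace ℂ H] [CompleteSpace H]
    (ρ : X → (H →L[ℂ] H)) : Prop where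
  entropyQGivenC_ne_top : entropyQGivenC μ ρ ≠ ∞
  integrable_classical : Integrable (fun ξ => Real.negMulLog (classicalMarginal ρ ξ)) μ
  entropyQ_ne_top : vonNeumannEntropy (quantumMarginal μ ρ) ≠ ∞

/-- The entropy `S(R|M) = S(M|R) + S(R) - S(M)` of the classical system conditioned on the
quantum system; meaningful under `HasFiniteEntropies μ ρ`. -/
def condEntropy {X : Type*} [MeasurableSpace X] (μ : Measure X)
    {H : Type*} [NormedAddCommGroup H] [InnerProductSpace ℂ H] [CompleteSpace H]
    (ρ : X → (H →L[ℂ] H)) : ℝ :=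
  (entropyQGivenC μ ρ).toReal + shannonEntropy μ (classicalMarginal ρ)
    - (vonNeumannEntropy (quantumMarginal μ ρ)).toReal

/-- The marginal on `RM` of a state of `RZM`, with `R` and `Z` classical. -/
def marginalFst {X Y : Type*} [MeasurableSpace Y] (ν : Measure Y)
    {H : Type*} [NormedAddCommGroup H] [InnerProductSpace ℂ H] [CompleteSpace H]
    (σ : X × Y → (H →L[ℂ] H)) (x : X) : H →L[ℂ] H :=
  ∫ y, σ (x, y) ∂ν

/-- The marginal on `ZM` of a state of `RZM`, with `R` and `Z` classical. -/
def marginalSnd {X Y : Type*} [MeasurableSpace X] (μ : Measure X)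
    {H : Type*} [NormedAddCommGroup H] [InnerProductSpace ℂ H] [CompleteSpace H]
    (σ : X × Y → (H →L[ℂ] H)) (y : Y) : H →L[ℂ] H :=
  ∫ x, σ (x, y) ∂μ

/-- The conditional mutual information `I(R:Z|M) = S(R|M) + S(Z|M) - S(RZ|M)` of a state of
`RZM`, with `R` and `Z` classical. -/
def condMutualInfo {X Y : Type*} [MeasurableSpace X] [MeasurableSpace Y]
    (μ : Measure X) (ν : Measure Y)
    {H : Type*} [NormedAddCommGroup H] [InnerProductSpace ℂ H] [CompleteSpace H]
    (σ : X × Y → (H →L[ℂ] H)) : ℝ :=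
  condEntropy μ (marginalFst ν σ) + condEntropy ν (marginalSnd μ σ)
    - condEntropy (μ.prod ν) σ

/-! ### Phase space, heat flow and integral conditional Fisher information -/

/-- The phase space `ℝ²ⁿ` with its Euclidean norm. -/
abbrev PhaseSpace (n : ℕ) : Type := EuclideanSpace ℝ (Fin (2 * n))

/-- The rescaled Lebesgue measure `d²ⁿξ / (2π)ⁿ`. -/
def phaseMeasure (n : ℕ) : Measure (PhaseSpace n) :=
  ENNReal.ofReal (((2 * Real.pi) ^ n)⁻¹) • volume

/-- The Gaussian density `f_{Z,t}(z) = exp (-|z|² / (2t)) / tⁿ` with respect to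
`d²ⁿz / (2π)ⁿ`; its covariance matrix is `t` times the identity. -/
def gaussianDensity (n : ℕ) (t : ℝ) (z : PhaseSpace n) : ℝ :=
  Real.exp (-‖z‖ ^ 2 / (2 * t)) / t ^ n

/-- The displacement `ρ_RM^{(z,0)}` of the classical system by `z`. -/
def displaceClassical {n : ℕ}
    {H : Type*} [NormedAddCommGroup H] [InnerProductSpace ℂ H] [CompleteSpace H]
    (z : PhaseSpace n) (ρ : PhaseSpace n → (H →L[ℂ] H)) (ξ : PhaseSpace n) : H →L[ℂ] H :=
  ρ (ξ - z)

open Classical in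
/-- The classical heat semigroup `(N_cl(t) ⊗ 1_M)(ρ_RM)`. -/
def heatFlow {n : ℕ}
    {H : Type*} [NormedAddCommGroup H] [InnerProductSpace ℂ H] [CompleteSpace H]
    (t : ℝ) (ρ : PhaseSpace n → (H →L[ℂ] H)) : PhaseSpace n → (H →L[ℂ] H) :=
  if t = 0 then ρ
  else fun η => ∫ ξ, gaussianDensity n t ξ • displaceClassical ξ ρ η ∂(phaseMeasure n)

/-- The state `σ_RZM(t)` whose marginal on `Z` is `f_{Z,t}` and whose conditional state on `RM`
given `Z = z` is `ρ_RM^{(z,0)}`. -/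
def displacedState {n : ℕ}
    {H : Type*} [NormedAddCommGroup H] [InnerProductSpace ℂ H] [CompleteSpace H]
    (t : ℝ) (ρ : PhaseSpace n → (H →L[ℂ] H)) (p : PhaseSpace n × PhaseSpace n) : H →L[ℂ] H :=
  gaussianDensity n t p.2 • displaceClassical p.2 ρ p.1

open Classical in
/-- The integral conditional Fisher information `Δ_{R|M}(ρ_RM)(t) = I(R:Z|M)` of `σ_RZM(t)` for
`t > 0`, with `Δ_{R|M}(ρ_RM)(0) = 0`. -/
def integralFisherInfo {n : ℕ}
    {H : Type*} [NormedAddCommGroup H] [InnerProductSpace ℂ H] [CompleteSpace H]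
    (ρ : PhaseSpace n → (H →L[ℂ] H)) (t : ℝ) : ℝ :=
  if t = 0 then 0
  else condMutualInfo (phaseMeasure n) (phaseMeasure n) (displacedState t ρ)

end

/-! All three conditional entropies of `displacedState t ρ` can be computed. Its `RM` marginal is by
construction the heat-flowed state. Its `ZM` marginal is the product of the Gaussian with `ρ_M`, by
translation invariance, so `S(Z|M)` is the Gaussian entropy `S(f)`. The shear `(ξ, z) ↦ (ξ - z, z)`
preserves the measure and turns the state on `RZM` into the product of `ρ` and the Gaussian, so
`S(RZ|M) = S(R|M)_ρ + S(f)`. In the mutual information `S(f)` cancels.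

The analytic work is to justify Tonelli and `tr ρ_M = 1` when `H` may be nonseparable and `opTrace`
an uncountable sum. `IsCQState.exists_countable_support` reduces it to a countable one, and
`diagEntry_cfc_negMulLog` carries this over to the entropy. -/

/-! ### Trace and diagonal entries of positive operators -/

section OperatorTrace

variable {H : Type*} [NormedAddCommGroup H] [InnerProductSpace ℂ H] [CompleteSpace H]

/-- The index set of the Hilbert basis used in `opTrace`. -/
abbrev TraceIndex (H : Type*) [NormedAddCommGroup H] [InnerProductSpace ℂ H]
    [CompleteSpace H] : Type _ :=
  (exists_hilbertBasis ℂ H).choose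

/-- The Hilbert basis used in `opTrace`. -/
noncomputable def traceBasis (H : Type*) [NormedAddCommGroup H] [InnerProductSpace ℂ H]
    [CompleteSpace H] : HilbertBasis (TraceIndex H) ℂ H :=
  (exists_hilbertBasis ℂ H).choose_spec.choose

/-- The diagonal entry `A ↦ re ⟨bᵢ, A bᵢ⟩` as a continuous real linear functional. -/
noncomputable def diagEntry (i : TraceIndex H) : (H →L[ℂ] H) →L[ℝ] ℝ :=
  Complex.reCLM ∘L ((innerSL ℂ (traceBasis H i)).restrictScalars ℝ) ∘L
    ((ContinuousLinearMap.apply ℂ H (traceBasis H i)).restrictScalars ℝ)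

theorem diagEntry_apply (i : TraceIndex H) (A : H →L[ℂ] H) :
    diagEntry i A = (inner ℂ (traceBasis H i) (A (traceBasis H i))).re := rfl

theorem opTrace_eq_tsum_diagEntry (A : H →L[ℂ] H) :
    opTrace A = ∑' i : TraceIndex H, ENNReal.ofReal (diagEntry i A) := rfl

theorem ContinuousLinearMap.IsPositive.diagEntry_nonneg {A : H →L[ℂ] H} (hA : A.IsPositive)
    (i : TraceIndex H) : 0 ≤ diagEntry i A :=
  hA.re_inner_nonneg_right _

theorem opTrace_real_smul {c : ℝ} (hc : 0 ≤ c) (A : H →L[ℂ] H) :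
    opTrace (c • A) = ENNReal.ofReal c * opTrace A := by
  simp only [opTrace_eq_tsum_diagEntry, map_smul, smul_eq_mul, ENNReal.ofReal_mul hc,
    ENNReal.tsum_mul_left]

theorem diagEntry_star_mul_self (S : H →L[ℂ] H) (i : TraceIndex H) :
    diagEntry i (star S * S) = ‖S (traceBasis H i)‖ ^ 2 := by
  rw [diagEntry_apply, mul_apply_eq_comp, ContinuousLinearMap.star_eq_adjoint,
    ContinuousLinearMap.adjoint_inner_right]
  exact inner_self_eq_norm_sq (𝕜 := ℂ) _

theorem ContinuousLinearMap.IsPositive.exists_star_mul_self {A : H →L[ℂ] H}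
    (hA : A.IsPositive) : ∃ S : H →L[ℂ] H, A = star S * S :=
  CStarAlgebra.nonneg_iff_eq_star_mul_self.mp
    ((ContinuousLinearMap.nonneg_iff_isPositive A).mpr hA)

/-- The operator norm of a positive operator is at most its trace. -/
theorem ContinuousLinearMap.IsPositive.enorm_le_opTrace {A : H →L[ℂ] H}
    (hA : A.IsPositive) : ‖A‖ₑ ≤ opTrace A := by
  by_cases htop : opTrace A = ∞
  · simp [htop]
  obtain ⟨S, rfl⟩ := hA.exists_star_mul_self
  have hsum : Summable fun i : TraceIndex H => ‖S (traceBasis H i)‖ ^ 2 := by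
    rw [opTrace_eq_tsum_diagEntry] at htop
    refine (ENNReal.summable_toReal htop).congr fun i => ?_
    rw [diagEntry_star_mul_self, ENNReal.toReal_ofReal (by positivity)]
  have htr : opTrace (star S * S) = ENNReal.ofReal (∑' i, ‖S (traceBasis H i)‖ ^ 2) := by
    rw [ENNReal.ofReal_tsum_of_nonneg (fun i => by positivity) hsum, opTrace_eq_tsum_diagEntry]
    simp only [diagEntry_star_mul_self]
  set T := ∑' i, ‖S (traceBasis H i)‖ ^ 2 with hT
  have hT0 : 0 ≤ T := tsum_nonneg fun i => by positivity
  -- The trace controls the vectors `S bᵢ`, so Parseval is applied to `star S x`, whose coefficients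
  -- are `⟨bᵢ, S* x⟩ = ⟨S bᵢ, x⟩`; Cauchy–Schwarz bounds each of them.
  have hbound : ‖star S‖ ≤ √T := by
    refine ContinuousLinearMap.opNorm_le_bound _ (Real.sqrt_nonneg _) fun x => ?_
    have hpars := (traceBasis H).hasSum_inner_mul_inner (star S x) (star S x)
    have hpars' : HasSum (fun i => ‖inner ℂ (S (traceBasis H i)) x‖ ^ 2) (‖star S x‖ ^ 2) := by
      have := Complex.reCLM.hasSum hpars
      convert this using 1
      · funext i
        simp only [Complex.reCLM_apply]
        rw [ContinuousLinearMap.star_eq_adjoint, ContinuousLinearMap.adjoint_inner_left,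
          ContinuousLinearMap.adjoint_inner_right, ← inner_conj_symm x,
          ← Complex.normSq_eq_conj_mul_self, Complex.ofReal_re, Complex.normSq_eq_norm_sq]
      · exact (inner_self_eq_norm_sq (𝕜 := ℂ) _).symm
    have hle : ‖star S x‖ ^ 2 ≤ T * ‖x‖ ^ 2 := by
      refine hasSum_le (fun i => ?_) hpars' (hsum.hasSum.mul_right _)
      rw [← mul_pow]
      gcongr
      exact norm_inner_le_norm _ _
    have : ‖star S x‖ = √(‖star S x‖ ^ 2) := by rw [Real.sqrt_sq (norm_nonneg _)]
    rw [this]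
    refine (Real.sqrt_le_sqrt hle).trans_eq ?_
    rw [Real.sqrt_mul hT0, Real.sqrt_sq (norm_nonneg _)]
  rw [htr, ← ofReal_norm]
  refine ENNReal.ofReal_le_ofReal ?_
  rw [CStarRing.norm_star_mul_self, ← norm_star]
  calc ‖star S‖ * ‖star S‖ ≤ √T * √T := by gcongr
    _ = T := Real.mul_self_sqrt hT0

/-- Since `⟨b, A b⟩ = ‖√A b‖²`, a vanishing entry means `√A b = 0`, and `-x log x` is a continuous
function times `√x`. -/
theorem diagEntry_cfc_negMulLog {A : H →L[ℂ] H} (hA : A.IsPositive) {i : TraceIndex H}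
    (h : diagEntry i A = 0) : diagEntry i (cfc Real.negMulLog A) = 0 := by
  have hA0 : 0 ≤ A := (ContinuousLinearMap.nonneg_iff_isPositive A).mpr hA
  have hsa : IsSelfAdjoint A := hA.isSelfAdjoint
  have hfac : cfc Real.negMulLog A
      = cfc (fun x => 2 * Real.negMulLog √x) A * cfc Real.sqrt A := by
    rw [← cfc_mul _ _ A (by fun_prop) (by fun_prop)]
    refine cfc_congr fun x hx => ?_
    have hx0 : 0 ≤ x := spectrum_nonneg_of_nonneg hA0 hx
    simp only [Real.negMulLog, Real.log_sqrt hx0]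
    nth_rewrite 1 [← Real.mul_self_sqrt hx0]
    ring
  have hsq : star (cfc Real.sqrt A) * cfc Real.sqrt A = A := by
    rw [(cfc_predicate (R := ℝ) Real.sqrt A : IsSelfAdjoint _).star_eq,
      ← cfc_mul _ _ A (by fun_prop) (by fun_prop)]
    conv_rhs => rw [← cfc_id ℝ A]
    exact cfc_congr fun x hx => Real.mul_self_sqrt (spectrum_nonneg_of_nonneg hA0 hx)
  rw [← hsq, diagEntry_star_mul_self] at h
  have h0 : cfc Real.sqrt A (traceBasis H i) = 0 := by simpa using h
  rw [diagEntry_apply, hfac, mul_apply_eq_comp, h0]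
  simp

theorem classicalMarginal_nonneg {X : Type*} (ρ : X → (H →L[ℂ] H)) (ξ : X) :
    0 ≤ classicalMarginal ρ ξ :=
  ENNReal.toReal_nonneg

end OperatorTrace

/-! ### Measurability and integrability for classical-quantum states -/

section ClassicalQuantum

variable {H : Type*} [NormedAddCommGroup H] [InnerProductSpace ℂ H] [CompleteSpace H]
  {X : Type*} [MeasurableSpace X] {μ : Measure X}

theorem opTrace_eq_tsum_subtype {A : H →L[ℂ] H} {I : Set (TraceIndex H)}
    (h : ∀ i ∉ I, diagEntry i A = 0) :
    opTrace A = ∑' i : I, ENNReal.ofReal (diagEntry (i : TraceIndex H) A) := by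
  rw [opTrace_eq_tsum_diagEntry]
  refine (tsum_subtype_eq_of_support_subset
    (f := fun i => ENNReal.ofReal (diagEntry i A)) fun i hi => ?_).symm
  by_contra hiI
  exact hi (by simp [h i hiI])

theorem measurable_opTrace {A : X → (H →L[ℂ] H)} (hA : StronglyMeasurable A)
    {I : Set (TraceIndex H)} (hI : I.Countable) (h : ∀ ξ, ∀ i ∉ I, diagEntry i (A ξ) = 0) :
    Measurable fun ξ => opTrace (A ξ) := by
  have := hI.to_subtype
  simp_rw [fun ξ => opTrace_eq_tsum_subtype (h ξ)]
  exact Measurable.tsum fun i =>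
    ((diagEntry (i : TraceIndex H)).continuous.comp_stronglyMeasurable
      hA).measurable.ennreal_ofReal

namespace IsCQState

variable {ρ : X → (H →L[ℂ] H)}

/-- Only countably many basis vectors are seen by the operators of a measurable family. -/
theorem exists_countable_support (hρ : IsCQState μ ρ) :
    ∃ I : Set (TraceIndex H), I.Countable ∧ ∀ ξ, ∀ i ∉ I, diagEntry i (ρ ξ) = 0 := by
  obtain ⟨D, hDr, hDc, hD⟩ :=
    hρ.stronglyMeasurable.isSeparable_range.exists_countable_dense_subset
  -- Each value in the countable dense set `D` has finite trace, hence countably many nonzero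
  -- entries; vanishing of an entry is a closed condition, so it passes to the closure.
  refine ⟨⋃ d ∈ D, Function.support fun i : TraceIndex H => ENNReal.ofReal (diagEntry i d),
    hDc.biUnion fun d hd => ?_, fun ξ i hi => ?_⟩
  · obtain ⟨ξ, rfl⟩ := hDr hd
    exact Summable.countable_support_ennreal (hρ.trace_ne_top ξ)
  · have hz : ∀ d ∈ D, diagEntry i d = 0 := fun d hd => by
      obtain ⟨η, rfl⟩ := hDr hd
      have : ENNReal.ofReal (diagEntry i (ρ η)) = 0 := by
        by_contra hne
        exact hi (Set.mem_biUnion hd hne)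
      exact le_antisymm (ENNReal.ofReal_eq_zero.mp this) ((hρ.isPositive η).diagEntry_nonneg i)
    have hcl : IsClosed {A : H →L[ℂ] H | diagEntry i A = 0} :=
      isClosed_eq (diagEntry i).continuous continuous_const
    exact closure_minimal hz hcl (hD ⟨ξ, rfl⟩)

theorem measurable_trace (hρ : IsCQState μ ρ) : Measurable fun ξ => opTrace (ρ ξ) := by
  obtain ⟨I, hI, h⟩ := hρ.exists_countable_support
  exact measurable_opTrace hρ.stronglyMeasurable hI h

theorem measurable_classicalMarginal (hρ : IsCQState μ ρ) : Measurable (classicalMarginal ρ) :=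
  hρ.measurable_trace.ennreal_toReal

theorem ofReal_classicalMarginal (hρ : IsCQState μ ρ) (ξ : X) :
    ENNReal.ofReal (classicalMarginal ρ ξ) = opTrace (ρ ξ) :=
  ENNReal.ofReal_toReal (hρ.trace_ne_top ξ)

theorem integrable_classicalMarginal (hρ : IsCQState μ ρ) :
    Integrable (classicalMarginal ρ) μ :=
  integrable_toReal_of_lintegral_ne_top hρ.measurable_trace.aemeasurable
    (by simp [hρ.lintegral_trace])

theorem integral_classicalMarginal (hρ : IsCQState μ ρ) :
    ∫ ξ, classicalMarginal ρ ξ ∂μ = 1 := by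
  rw [integral_eq_lintegral_of_nonneg_ae
    (Filter.Eventually.of_forall (classicalMarginal_nonneg ρ))
    hρ.measurable_classicalMarginal.aestronglyMeasurable]
  simp [hρ.ofReal_classicalMarginal, hρ.lintegral_trace]

theorem integrable (hρ : IsCQState μ ρ) : Integrable ρ μ := by
  refine ⟨hρ.stronglyMeasurable.aestronglyMeasurable, ?_⟩
  refine (lintegral_mono fun ξ => (hρ.isPositive ξ).enorm_le_opTrace).trans_lt ?_
  simp [hρ.lintegral_trace]

/-- The Bochner integral is in operator norm, for which the trace is not continuous; the single
entries are, and the countable support permits exchanging sum and integral. -/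
theorem opTrace_quantumMarginal (hρ : IsCQState μ ρ) : opTrace (quantumMarginal μ ρ) = 1 := by
  obtain ⟨I, hI, h⟩ := hρ.exists_countable_support
  have := hI.to_subtype
  have hentry (i : TraceIndex H) :
      diagEntry i (quantumMarginal μ ρ) = ∫ ξ, diagEntry i (ρ ξ) ∂μ :=
    ((diagEntry i).integral_comp_comm hρ.integrable).symm
  rw [opTrace_eq_tsum_subtype (I := I) fun i hi => by simp [hentry, h _ i hi],
    ← hρ.lintegral_trace]
  simp_rw [fun ξ => opTrace_eq_tsum_subtype (h ξ)]
  rw [lintegral_tsum fun i : I => ((diagEntry (i : TraceIndex H)).continuous.comp_stronglyMeasurable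
      hρ.stronglyMeasurable).measurable.ennreal_ofReal.aemeasurable]
  refine tsum_congr fun i => ?_
  rw [hentry, ofReal_integral_eq_lintegral_ofReal
    ((diagEntry (i : TraceIndex H)).integrable_comp hρ.integrable)
    (Filter.Eventually.of_forall fun ξ => (hρ.isPositive ξ).diagEntry_nonneg _)]

theorem isPositive_conditionalState (hρ : IsCQState μ ρ) (ξ : X) :
    (conditionalState ρ ξ).IsPositive := by
  rw [← ContinuousLinearMap.nonneg_iff_isPositive]
  exact smul_nonneg (inv_nonneg.mpr (classicalMarginal_nonneg ρ ξ))
    ((ContinuousLinearMap.nonneg_iff_isPositive _).mpr (hρ.isPositive ξ))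

theorem norm_conditionalState_le_one (hρ : IsCQState μ ρ) (ξ : X) :
    ‖conditionalState ρ ξ‖ ≤ 1 := by
  have h := (hρ.isPositive ξ).enorm_le_opTrace
  have h' : ‖ρ ξ‖ ≤ classicalMarginal ρ ξ := by
    simpa [classicalMarginal] using ENNReal.toReal_mono (hρ.trace_ne_top ξ) h
  rw [conditionalState, norm_smul, norm_inv, Real.norm_of_nonneg (classicalMarginal_nonneg ρ ξ)]
  exact inv_mul_le_one_of_le₀ h' (classicalMarginal_nonneg ρ ξ)

theorem stronglyMeasurable_conditionalState (hρ : IsCQState μ ρ) :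
    StronglyMeasurable (conditionalState ρ) :=
  hρ.measurable_classicalMarginal.inv.stronglyMeasurable.smul hρ.stronglyMeasurable

theorem measurable_vonNeumannEntropy_conditionalState (hρ : IsCQState μ ρ) :
    Measurable fun ξ => vonNeumannEntropy (conditionalState ρ ξ) := by
  obtain ⟨I, hI, h⟩ := hρ.exists_countable_support
  refine measurable_opTrace ?_ hI fun ξ i hi =>
    diagEntry_cfc_negMulLog (hρ.isPositive_conditionalState ξ) ?_
  -- Continuity of `A ↦ cfc f A` requires the spectra to stay in one compact set, which the norm
  -- bound on conditional states provides.
  · let s : Set (H →L[ℂ] H) := {A | IsSelfAdjoint A ∧ ‖A‖ ≤ 1}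
    have hs (ξ : X) : conditionalState ρ ξ ∈ s :=
      ⟨(hρ.isPositive_conditionalState ξ).isSelfAdjoint, hρ.norm_conditionalState_le_one ξ⟩
    have hcont : ContinuousOn (fun A : H →L[ℂ] H => cfc Real.negMulLog A) s := by
      -- The radius is `‖1‖` because the spectral bound used is `‖A‖ * ‖1‖`; no nontriviality of `H`
      -- is then needed.
      refine ContinuousOn.cfc' (isCompact_closedBall (0 : ℝ) ‖(1 : H →L[ℂ] H)‖) _
        continuousOn_id (fun A hA => ?_) (fun A hA => hA.1)
        Real.continuous_negMulLog.continuousOn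
      refine (spectrum.subset_closedBall_norm_mul A).trans (Metric.closedBall_subset_closedBall ?_)
      exact mul_le_of_le_one_left (norm_nonneg _) hA.2
    have hmeas : StronglyMeasurable fun ξ => (⟨conditionalState ρ ξ, hs ξ⟩ : s) :=
      (Embedding.comp_stronglyMeasurable_iff Topology.IsEmbedding.subtypeVal).mp
        hρ.stronglyMeasurable_conditionalState
    exact (continuousOn_iff_continuous_domRestrict.mp hcont).comp_stronglyMeasurable hmeas
  · rw [conditionalState, map_smul, h ξ i hi, smul_zero]

end IsCQState

end ClassicalQuantum

/-! ### The Gaussian density and its entropy -/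

section Gaussian

instance isAddHaarMeasure_phaseMeasure (n : ℕ) : (phaseMeasure n).IsAddHaarMeasure :=
  Measure.IsAddHaarMeasure.smul _ (by simp; positivity) ENNReal.ofReal_ne_top

theorem integral_phaseMeasure {n : ℕ} {E : Type*} [NormedAddCommGroup E] [NormedSpace ℝ E]
    (f : PhaseSpace n → E) :
    ∫ z, f z ∂(phaseMeasure n) = ((2 * Real.pi) ^ n)⁻¹ • ∫ z, f z := by
  rw [phaseMeasure, integral_smul_measure, ENNReal.toReal_ofReal (by positivity)]

theorem gaussianDensity_pos {n : ℕ} {t : ℝ} (ht : 0 < t) (z : PhaseSpace n) :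
    0 < gaussianDensity n t z := by
  unfold gaussianDensity; positivity

theorem continuous_gaussianDensity (n : ℕ) (t : ℝ) : Continuous (gaussianDensity n t) := by
  unfold gaussianDensity; fun_prop

theorem integral_exp_neg_norm_sq_phaseMeasure (n : ℕ) {t : ℝ} (ht : 0 < t) :
    ∫ z : PhaseSpace n, Real.exp (-‖z‖ ^ 2 / (2 * t)) ∂(phaseMeasure n) = t ^ n := by
  have h := GaussianFourier.integral_rexp_neg_mul_sq_norm (V := PhaseSpace n)
    (b := 1 / (2 * t)) (by positivity)
  have hexp : ∀ z : PhaseSpace n,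
      Real.exp (-‖z‖ ^ 2 / (2 * t)) = Real.exp (-(1 / (2 * t)) * ‖z‖ ^ 2) := fun z => by
    congr 1; ring
  rw [integral_phaseMeasure]
  simp_rw [hexp]
  rw [h, finrank_euclideanSpace_fin]
  have : ((2 * n : ℕ) : ℝ) / 2 = n := by push_cast; ring
  rw [this, Real.rpow_natCast, smul_eq_mul, ← inv_pow, ← mul_pow]
  congr 1
  field_simp

theorem integral_gaussianDensity (n : ℕ) {t : ℝ} (ht : 0 < t) :
    ∫ z, gaussianDensity n t z ∂(phaseMeasure n) = 1 := by
  unfold gaussianDensity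
  rw [integral_div, integral_exp_neg_norm_sq_phaseMeasure n ht, div_self (by positivity)]

theorem integrable_gaussianDensity (n : ℕ) {t : ℝ} (ht : 0 < t) :
    Integrable (gaussianDensity n t) (phaseMeasure n) :=
  -- A non-integrable function has Bochner integral `0` by convention, so the value `1` forces
  -- integrability.
  .of_integral_ne_zero (by simp [integral_gaussianDensity n ht])

theorem lintegral_ofReal_gaussianDensity (n : ℕ) {t : ℝ} (ht : 0 < t) :
    ∫⁻ z, ENNReal.ofReal (gaussianDensity n t z) ∂(phaseMeasure n) = 1 := by
  rw [← ofReal_integral_eq_lintegral_ofReal (integrable_gaussianDensity n ht)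
    (Filter.Eventually.of_forall fun z => (gaussianDensity_pos ht z).le),
    integral_gaussianDensity n ht, ENNReal.ofReal_one]

theorem integrable_negMulLog_gaussianDensity (n : ℕ) {t : ℝ} (ht : 0 < t) :
    Integrable (fun z => Real.negMulLog (gaussianDensity n t z)) (phaseMeasure n) := by
  have hlog (z : PhaseSpace n) : Real.negMulLog (gaussianDensity n t z)
      = gaussianDensity n t z * (‖z‖ ^ 2 / (2 * t)) + Real.log (t ^ n) * gaussianDensity n t z := by
    rw [Real.negMulLog]
    nth_rewrite 2 [gaussianDensity]
    rw [Real.log_div (Real.exp_ne_zero _) (by positivity), Real.log_exp]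
    ring
  simp_rw [hlog]
  refine .add ?_ ((integrable_gaussianDensity n ht).const_mul _)
  -- Half of the exponent absorbs `‖z‖²` through `y * exp (-y) ≤ 1` with `y = ‖z‖² / (4t)`. The rest
  -- is a Gaussian of variance `2t`; `2 ^ n` corrects its normalisation and `2` comes from `‖z‖² /
  -- (2t) = 2y`.
  refine Integrable.mono' ((integrable_gaussianDensity n (t := 2 * t) (by positivity)).const_mul
    (2 * 2 ^ n)) ?_ (Filter.Eventually.of_forall fun z => ?_)
  · exact ((continuous_gaussianDensity n t).mul (by fun_prop)).aestronglyMeasurable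
  · rw [Real.norm_of_nonneg (mul_nonneg (gaussianDensity_pos ht z).le (by positivity))]
    set y : ℝ := ‖z‖ ^ 2 / (2 * (2 * t)) with hy
    have h1 : -‖z‖ ^ 2 / (2 * t) = -y + -y := by rw [hy]; field_simp; ring
    have h2 : ‖z‖ ^ 2 / (2 * t) = 2 * y := by rw [hy]; field_simp
    have h3 : -‖z‖ ^ 2 / (2 * (2 * t)) = -y := by rw [hy]; ring
    have h4 : y * Real.exp (-y) ≤ 1 := by
      have := Real.add_one_le_exp y
      rw [Real.exp_neg, ← div_eq_mul_inv, div_le_one (Real.exp_pos y)]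
      linarith
    unfold gaussianDensity
    rw [h1, h2, h3, Real.exp_add, mul_pow]
    calc Real.exp (-y) * Real.exp (-y) / t ^ n * (2 * y)
        = 2 * (Real.exp (-y) / t ^ n) * (y * Real.exp (-y)) := by ring
      _ ≤ 2 * (Real.exp (-y) / t ^ n) * 1 := by gcongr
      _ = 2 * 2 ^ n * (Real.exp (-y) / (2 ^ n * t ^ n)) := by field_simp

end Gaussian

/-! ### Entropies of the displaced state and its marginals -/

section DisplacedState

variable {H : Type*} [NormedAddCommGroup H] [InnerProductSpace ℂ H] [CompleteSpace H]
  {n : ℕ} {ρ : PhaseSpace n → (H →L[ℂ] H)} {t : ℝ}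

theorem classicalMarginal_real_smul {X : Type*} {c : X → ℝ} (hc : ∀ x, 0 ≤ c x)
    (σ : X → (H →L[ℂ] H)) (x : X) :
    classicalMarginal (fun x => c x • σ x) x = c x * classicalMarginal σ x := by
  rw [classicalMarginal, opTrace_real_smul (hc x), ENNReal.toReal_mul,
    ENNReal.toReal_ofReal (hc x), classicalMarginal]

theorem conditionalState_real_smul {X : Type*} {c : X → ℝ} (hc : ∀ x, 0 < c x)
    (σ : X → (H →L[ℂ] H)) (x : X) :
    conditionalState (fun x => c x • σ x) x = conditionalState σ x := by
  rw [conditionalState, classicalMarginal_real_smul (fun x => (hc x).le), smul_smul,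
    conditionalState]
  congr 1
  rw [mul_inv, mul_comm, ← mul_assoc, mul_inv_cancel₀ (hc x).ne', one_mul]

theorem marginalFst_displacedState (ht : t ≠ 0) (ρ : PhaseSpace n → (H →L[ℂ] H)) :
    marginalFst (phaseMeasure n) (displacedState t ρ) = heatFlow t ρ := by
  rw [heatFlow, if_neg ht]
  rfl

theorem marginalSnd_displacedState (t : ℝ) (ρ : PhaseSpace n → (H →L[ℂ] H)) :
    marginalSnd (phaseMeasure n) (displacedState t ρ)
      = fun z => gaussianDensity n t z • quantumMarginal (phaseMeasure n) ρ := by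
  funext z
  simp only [marginalSnd, displacedState, displaceClassical, quantumMarginal]
  rw [integral_smul, integral_sub_right_eq_self ρ z]

theorem quantumMarginal_gaussianDensity_smul (ht : 0 < t) (A : H →L[ℂ] H) :
    quantumMarginal (phaseMeasure n) (fun z => gaussianDensity n t z • A) = A := by
  rw [quantumMarginal, integral_smul_const, integral_gaussianDensity n ht, one_smul]

theorem classicalMarginal_gaussianDensity_smul (ht : 0 < t) {A : H →L[ℂ] H}
    (hA : opTrace A = 1) :
    classicalMarginal (fun z => gaussianDensity n t z • A) = gaussianDensity n t := by
  funext z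
  rw [classicalMarginal_real_smul (fun z => (gaussianDensity_pos ht z).le), classicalMarginal,
    hA, ENNReal.toReal_one, mul_one]

theorem entropyQGivenC_gaussianDensity_smul (ht : 0 < t) {A : H →L[ℂ] H}
    (hA : opTrace A = 1) :
    entropyQGivenC (phaseMeasure n) (fun z => gaussianDensity n t z • A)
      = vonNeumannEntropy A := by
  have hcond (z : PhaseSpace n) : conditionalState (fun z => gaussianDensity n t z • A) z = A := by
    rw [conditionalState_real_smul (gaussianDensity_pos ht), conditionalState, classicalMarginal,
      hA, ENNReal.toReal_one, inv_one, one_smul]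
  simp_rw [entropyQGivenC, hcond, classicalMarginal_gaussianDensity_smul ht hA]
  rw [lintegral_const_mul _ (continuous_gaussianDensity n t).measurable.ennreal_ofReal,
    lintegral_ofReal_gaussianDensity n ht, mul_one]

theorem measurePreserving_displacement (n : ℕ) :
    MeasurePreserving (fun p : PhaseSpace n × PhaseSpace n => (p.1 - p.2, p.2))
      ((phaseMeasure n).prod (phaseMeasure n)) ((phaseMeasure n).prod (phaseMeasure n)) :=
  measurePreserving_sub_prod _ _

theorem measurableEmbedding_displacement (n : ℕ) :
    MeasurableEmbedding (fun p : PhaseSpace n × PhaseSpace n => (p.1 - p.2, p.2)) :=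
  MeasurableEquiv.measurableEmbedding
    { toFun := fun p => (p.1 - p.2, p.2)
      invFun := fun p => (p.1 + p.2, p.2)
      left_inv := fun p => by simp
      right_inv := fun p => by simp
      measurable_toFun := by change Measurable fun p : _ × _ => (p.1 - p.2, p.2); fun_prop
      measurable_invFun := by change Measurable fun p : _ × _ => (p.1 + p.2, p.2); fun_prop }

theorem classicalMarginal_displacedState (ht : 0 < t) (ρ : PhaseSpace n → (H →L[ℂ] H))
    (p : PhaseSpace n × PhaseSpace n) :
    classicalMarginal (displacedState t ρ) p
      = classicalMarginal ρ (p.1 - p.2) * gaussianDensity n t p.2 := by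
  rw [mul_comm]
  exact classicalMarginal_real_smul (c := fun p : PhaseSpace n × PhaseSpace n =>
    gaussianDensity n t p.2) (fun p => (gaussianDensity_pos ht p.2).le)
    (fun p => ρ (p.1 - p.2)) p

theorem conditionalState_displacedState (ht : 0 < t) (ρ : PhaseSpace n → (H →L[ℂ] H))
    (p : PhaseSpace n × PhaseSpace n) :
    conditionalState (displacedState t ρ) p = conditionalState ρ (p.1 - p.2) :=
  conditionalState_real_smul (c := fun p : PhaseSpace n × PhaseSpace n =>
    gaussianDensity n t p.2) (fun p => gaussianDensity_pos ht p.2)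
    (fun p => ρ (p.1 - p.2)) p

theorem quantumMarginal_displacedState (ht : 0 < t) (ρ : PhaseSpace n → (H →L[ℂ] H)) :
    quantumMarginal ((phaseMeasure n).prod (phaseMeasure n)) (displacedState t ρ)
      = quantumMarginal (phaseMeasure n) ρ := by
  have h := (measurePreserving_displacement n).integral_comp (measurableEmbedding_displacement n)
    (fun p => gaussianDensity n t p.2 • ρ p.1)
  -- The swap puts the scalar factor on the first coordinate, as `integral_prod_smul` expects.
  have h' := ((Measure.measurePreserving_swap (μ := phaseMeasure n)
    (ν := phaseMeasure n)).integral_comp MeasurableEquiv.prodComm.measurableEmbedding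
    (fun p => gaussianDensity n t p.1 • ρ p.2))
  refine h.trans (h'.trans ?_)
  rw [integral_prod_smul, integral_gaussianDensity n ht, one_smul, quantumMarginal]

theorem entropyQGivenC_displacedState (hρ : IsCQState (phaseMeasure n) ρ) (ht : 0 < t) :
    entropyQGivenC ((phaseMeasure n).prod (phaseMeasure n)) (displacedState t ρ)
      = entropyQGivenC (phaseMeasure n) ρ := by
  have h := (measurePreserving_displacement n).lintegral_comp_emb
    (measurableEmbedding_displacement n) (fun p => vonNeumannEntropy (conditionalState ρ p.1) *
      ENNReal.ofReal (classicalMarginal ρ p.1) * ENNReal.ofReal (gaussianDensity n t p.2))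
  -- Tonelli for a product integrand needs this factor measurable; this is what the countable
  -- support is for.
  have hmeas : Measurable fun ξ => vonNeumannEntropy (conditionalState ρ ξ) *
      ENNReal.ofReal (classicalMarginal ρ ξ) :=
    hρ.measurable_vonNeumannEntropy_conditionalState.mul
      hρ.measurable_classicalMarginal.ennreal_ofReal
  rw [lintegral_prod_mul hmeas.aemeasurable
    (continuous_gaussianDensity n t).measurable.ennreal_ofReal.aemeasurable,
    lintegral_ofReal_gaussianDensity n ht, mul_one] at h
  simp_rw [entropyQGivenC, conditionalState_displacedState ht,
    classicalMarginal_displacedState ht, ENNReal.ofReal_mul (classicalMarginal_nonneg ρ _),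
    ← mul_assoc]
  exact h

theorem negMulLog_classicalMarginal_displacedState (ht : 0 < t)
    (ρ : PhaseSpace n → (H →L[ℂ] H)) (p : PhaseSpace n × PhaseSpace n) :
    Real.negMulLog (classicalMarginal (displacedState t ρ) p)
      = Real.negMulLog (classicalMarginal ρ (p.1 - p.2)) * gaussianDensity n t p.2
        + classicalMarginal ρ (p.1 - p.2) * Real.negMulLog (gaussianDensity n t p.2) := by
  rw [classicalMarginal_displacedState ht, Real.negMulLog_mul]
  ring

theorem integrable_negMulLog_displacedState (hρ : IsCQState (phaseMeasure n) ρ) (ht : 0 < t)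
    (hint : Integrable (fun ξ => Real.negMulLog (classicalMarginal ρ ξ)) (phaseMeasure n)) :
    Integrable (fun p => Real.negMulLog (classicalMarginal (displacedState t ρ) p))
      ((phaseMeasure n).prod (phaseMeasure n)) := by
  simp_rw [negMulLog_classicalMarginal_displacedState ht]
  exact ((measurePreserving_displacement n).integrable_comp_emb
    (measurableEmbedding_displacement n)).mpr
    ((hint.mul_prod (integrable_gaussianDensity n ht)).add
      (hρ.integrable_classicalMarginal.mul_prod (integrable_negMulLog_gaussianDensity n ht)))

theorem shannonEntropy_displacedState (hρ : IsCQState (phaseMeasure n) ρ) (ht : 0 < t)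
    (hint : Integrable (fun ξ => Real.negMulLog (classicalMarginal ρ ξ)) (phaseMeasure n)) :
    shannonEntropy ((phaseMeasure n).prod (phaseMeasure n))
        (classicalMarginal (displacedState t ρ))
      = shannonEntropy (phaseMeasure n) (classicalMarginal ρ)
        + shannonEntropy (phaseMeasure n) (gaussianDensity n t) := by
  have h := (measurePreserving_displacement n).integral_comp (measurableEmbedding_displacement n)
    (fun p => Real.negMulLog (classicalMarginal ρ p.1) * gaussianDensity n t p.2
        + classicalMarginal ρ p.1 * Real.negMulLog (gaussianDensity n t p.2))
  simp_rw [shannonEntropy, negMulLog_classicalMarginal_displacedState ht]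
  refine h.trans ?_
  rw [integral_add (hint.mul_prod (integrable_gaussianDensity n ht))
    (hρ.integrable_classicalMarginal.mul_prod (integrable_negMulLog_gaussianDensity n ht)),
    integral_prod_mul (fun ξ => Real.negMulLog (classicalMarginal ρ ξ)) (gaussianDensity n t),
    integral_prod_mul (classicalMarginal ρ) (fun z => Real.negMulLog (gaussianDensity n t z)),
    integral_gaussianDensity n ht,
    hρ.integral_classicalMarginal, mul_one, one_mul]

theorem hasFiniteEntropies_gaussianDensity_smul (ht : 0 < t) {A : H →L[ℂ] H}
    (hA : opTrace A = 1) (hS : vonNeumannEntropy A ≠ ∞) :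
    HasFiniteEntropies (phaseMeasure n) (fun z => gaussianDensity n t z • A) where
  entropyQGivenC_ne_top := by rwa [entropyQGivenC_gaussianDensity_smul ht hA]
  integrable_classical := by
    rw [classicalMarginal_gaussianDensity_smul ht hA]
    exact integrable_negMulLog_gaussianDensity n ht
  entropyQ_ne_top := by rwa [quantumMarginal_gaussianDensity_smul ht]

/-- By independence `S(M|Z) = S(M)`. The same `toReal` value is added and subtracted, so finiteness
plays no role here. -/
theorem condEntropy_gaussianDensity_smul (ht : 0 < t) {A : H →L[ℂ] H} (hA : opTrace A = 1) :
    condEntropy (phaseMeasure n) (fun z => gaussianDensity n t z • A)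
      = shannonEntropy (phaseMeasure n) (gaussianDensity n t) := by
  rw [condEntropy, entropyQGivenC_gaussianDensity_smul ht hA,
    classicalMarginal_gaussianDensity_smul ht hA, quantumMarginal_gaussianDensity_smul ht]
  ring

theorem hasFiniteEntropies_displacedState (hρ : IsCQState (phaseMeasure n) ρ) (ht : 0 < t)
    (hfin : HasFiniteEntropies (phaseMeasure n) ρ) :
    HasFiniteEntropies ((phaseMeasure n).prod (phaseMeasure n)) (displacedState t ρ) where
  entropyQGivenC_ne_top := by
    rw [entropyQGivenC_displacedState hρ ht]
    exact hfin.entropyQGivenC_ne_top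
  integrable_classical := integrable_negMulLog_displacedState hρ ht hfin.integrable_classical
  entropyQ_ne_top := by
    rw [quantumMarginal_displacedState ht]
    exact hfin.entropyQ_ne_top

theorem condEntropy_displacedState (hρ : IsCQState (phaseMeasure n) ρ) (ht : 0 < t)
    (hfin : HasFiniteEntropies (phaseMeasure n) ρ) :
    condEntropy ((phaseMeasure n).prod (phaseMeasure n)) (displacedState t ρ)
      = condEntropy (phaseMeasure n) ρ
        + shannonEntropy (phaseMeasure n) (gaussianDensity n t) := by
  rw [condEntropy, entropyQGivenC_displacedState hρ ht,
    shannonEntropy_displacedState hρ ht hfin.integrable_classical,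
    quantumMarginal_displacedState ht, condEntropy]
  ring

end DisplacedState

/-! ### The integral conditional de Bruijn identity -/

theorem mainTheorem7 {H : Type*} [NormedAddCommGroup H] [InnerProductSpace ℂ H]
    [CompleteSpace H] (n : ℕ) (ρ : PhaseSpace n → (H →L[ℂ] H))
    (hρ : IsCQState (phaseMeasure n) ρ) (t : ℝ) (ht : 0 ≤ t)
    (hfin : HasFiniteEntropies (phaseMeasure n) ρ)
    (hfin_t : HasFiniteEntropies (phaseMeasure n) (heatFlow t ρ)) :
    (0 < t →
      HasFiniteEntropies (phaseMeasure n)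
        (marginalFst (phaseMeasure n) (displacedState t ρ)) ∧
      HasFiniteEntropies (phaseMeasure n)
        (marginalSnd (phaseMeasure n) (displacedState t ρ)) ∧
      HasFiniteEntropies ((phaseMeasure n).prod (phaseMeasure n)) (displacedState t ρ)) ∧
    integralFisherInfo ρ t =
      condEntropy (phaseMeasure n) (heatFlow t ρ) - condEntropy (phaseMeasure n) ρ := by
  refine ⟨fun ht0 => ⟨?_, ?_, hasFiniteEntropies_displacedState hρ ht0 hfin⟩, ?_⟩
  · rwa [marginalFst_displacedState ht0.ne']
  · rw [marginalSnd_displacedState]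
    exact hasFiniteEntropies_gaussianDensity_smul ht0 hρ.opTrace_quantumMarginal
      hfin.entropyQ_ne_top
  · rcases ht.eq_or_lt with rfl | ht0
    · simp [integralFisherInfo, heatFlow]
    · rw [integralFisherInfo, if_neg ht0.ne', condMutualInfo,
        marginalFst_displacedState ht0.ne', marginalSnd_displacedState,
        condEntropy_gaussianDensity_smul ht0 hρ.opTrace_quantumMarginal,
        condEntropy_displacedState hρ ht0 hfin]
      ring
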